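/- Let $\alpha\approx 1.8392$ be the unique real root of $x^3-x^2-x-1$. There is an absolute constant $C>0$ such that the following holds for every $n\in\mathbb{N}$. A path $(v_1,\dots,v_t)$, $t\ge 1$, in a graph whose vertices are points of the plane is called monotone in direction $\mathbf{u}\in\mathbb{R}^2\setminus\{\mathbf{0}\}$ if $\langle v_{i+1}-v_i,\mathbf{u}\rangle>0$ for $i=1,\dots,t-1$; it is $x$-monotone if this holds for $\mathbf{u}=(1,0)$, and monotone if it holds for some $\mathbf{u}\neq\mathbf{0}$. (1) Every triangulation of $n$ points in the plane (an edge-maximal plane straight-line graph on these points), and more generally every plane straight-line graph on $n$ vertices (a graph on $n$ points whose edges are line segments that pass through no other vertex and pairwise intersect only at common endpoints), contains at most $C\alpha^n$ $x$-monotone paths and at most $C\,n\,\alpha^n$ monotone paths (over all directions). (2) Every plane monotone graph on $n$ vertices, that is, every simple graph embedded in the plane without crossings such that every edge is a Jordan arc meeting each vertical line in at most one point, contains at most $C\alpha^n$ $x$-monotone paths. -/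

import Mathlib

/-- The Euclidean plane. The coordinates of a point `p` are `p 0` (the `x`-coordinate) and `p 1`. -/
abbrev Plane : Type := EuclideanSpace ℝ (Fin 2)

/-- `A` is a Jordan arc with endpoints `a` and `b`. -/
def IsJordanArc (A : Set Plane) (a b : Plane) : Prop :=
  ∃ γ : unitInterval → Plane,
    Continuous γ ∧ Function.Injective γ ∧ γ 0 = a ∧ γ 1 = b ∧ Set.range γ = A

/-- The set `A` is `x`-monotone: every vertical line meets it in at most one point. -/
def IsXMonotone (A : Set Plane) : Prop :=
  ∀ p ∈ A, ∀ q ∈ A, p 0 = q 0 → p = q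

/-- `arc` is a plane embedding of the graph `G` whose vertices are the points of the finite set `P`:
every edge is a Jordan arc between its two endpoints, passing through no other vertex,
and two distinct edges meet at most in common endpoints. -/
structure IsPlaneEmbedding {P : Finset Plane} (G : SimpleGraph P) (arc : Sym2 P → Set Plane) :
    Prop where
  isJordanArc : ∀ a b : P, G.Adj a b → IsJordanArc (arc s(a, b)) a b
  vertex_mem : ∀ e ∈ G.edgeSet, ∀ v : P, (v : Plane) ∈ arc e → v ∈ e
  disjoint : ∀ e ∈ G.edgeSet, ∀ f ∈ G.edgeSet, e ≠ f →
    ∀ p ∈ arc e ∩ arc f, ∃ v : P, v ∈ e ∧ v ∈ f ∧ p = v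

/-- `G` is a plane monotone graph: it has a plane embedding on its vertex set `P` in which
every edge is an `x`-monotone Jordan arc. -/
def IsPlaneMonotone {P : Finset Plane} (G : SimpleGraph P) : Prop :=
  ∃ arc : Sym2 P → Set Plane, IsPlaneEmbedding G arc ∧ ∀ e ∈ G.edgeSet, IsXMonotone (arc e)

/-- `G` is a plane straight-line graph: drawing its edges as line segments is a plane embedding. -/
def IsPlaneStraightLine {P : Finset Plane} (G : SimpleGraph P) : Prop :=
  ∃ arc : Sym2 P → Set Plane, IsPlaneEmbedding G arc ∧
    ∀ a b : P, G.Adj a b → arc s(a, b) = segment ℝ (a : Plane) (b : Plane)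

/-- `G` is a triangulation of the point set `P`: an edge-maximal plane straight-line graph
with vertex set `P`. -/
def IsTriangulation {P : Finset Plane} (G : SimpleGraph P) : Prop :=
  Maximal (fun H : SimpleGraph P => IsPlaneStraightLine H) G

/-- The vertex sequence `l = (v₁, …, vₜ)`, `t ≥ 1`, is a path of `G` in which every directed edge
has a positive scalar product with `u`. For a straight-line graph this says that the path is
monotone in direction `u`; for a plane monotone graph and `u = (1, 0)` it says that the path, drawn
with the given `x`-monotone arcs, is `x`-monotone and directed from left to right. -/
def IsMonotonePathInDirection {P : Finset Plane} (G : SimpleGraph P) (u : Plane) (l : List P) :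
    Prop :=
  l ≠ [] ∧ l.IsChain (fun a b => G.Adj a b ∧ 0 < inner ℝ ((b : Plane) - (a : Plane)) u)

/-- The set of `x`-monotone paths of `G`. -/
def xMonotonePaths {P : Finset Plane} (G : SimpleGraph P) : Set (List P) :=
  {l | IsMonotonePathInDirection G !₂[(1 : ℝ), 0] l}

/-- The set of monotone paths of `G`, over all directions `u ≠ 0`. A path that is monotone in
direction `u` and its reversal, which is monotone in direction `-u`, are counted separately. -/
def monotonePaths {P : Finset Plane} (G : SimpleGraph P) : Set (List P) :=
  {l | ∃ u : Plane, u ≠ 0 ∧ IsMonotonePathInDirection G u l}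

/-! Fix a direction and orient each edge along it; monotone paths are then the directed paths of an
acyclic digraph. Two facts carry the bound for one direction.

Sparsity (`IsMonotoneDrawing.card_edges_le`): an edge is either the lowest one entering its right
endpoint, or it bounds a wedge with the edge just below it. A rightmost vertex of that wedge lies
strictly off one of its two sides, and a vertex serves at most one wedge for each side. This gives
`n + 2n` edges without Euler's formula, and the bound passes to induced subgraphs.

Counting (`sum_le_of_superharmonic`, `ncard_isChain_le`): fix the last vertex and add the other
vertices in decreasing order. The number of paths from a new vertex of out-degree `d` is at most the
sum of `d` earlier counts, so one controls sums over arbitrary `k`-sets by weights `c k`. Out-degree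
3 multiplies the bound by `α`; any other `d` costs an extra `1.09 ^ (d - 3)`. As there are at most
three edges per vertex, these corrections multiply to `O(1)`.

For all directions, a path only sees which edge vectors lie in the open half-plane of `u`. Up to
inclusion `O(n)` directions suffice (`exists_finset_directions`), whence the extra factor `n`. -/

/-- The root of `x ^ 3 - x ^ 2 - x - 1` lies between `1.8392` and `1.8393` and is unique. -/
theorem exists_tribonacci_constant :
    ∃ α : ℝ, (α ^ 3 - α ^ 2 - α - 1 = 0 ∧ (∀ y : ℝ, y ^ 3 - y ^ 2 - y - 1 = 0 → y = α) ∧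
        (1.8392 : ℝ) < α ∧ α < (1.8393 : ℝ)) := by
  have hc : ContinuousOn (fun x : ℝ => x ^ 3 - x ^ 2 - x - 1) (Set.Icc 1.8392 1.8393) := by
    fun_prop
  obtain ⟨α, ⟨h1, h2⟩, h0⟩ := intermediate_value_Ioo (by norm_num) hc
    (show (0 : ℝ) ∈ Set.Ioo _ _ by constructor <;> norm_num)
  have h0 : α ^ 3 - α ^ 2 - α - 1 = 0 := h0
  refine ⟨α, h0, fun y hy => ?_, h1, h2⟩
  have hfac : (y - α) * (y ^ 2 + (α - 1) * y + (α ^ 2 - α - 1)) = 0 := by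
    linear_combination hy - h0
  rcases mul_eq_zero.1 hfac with h | h
  · linarith
  -- The discriminant of the cofactor is `-(3 * α - 5) * (α + 1)`, negative since `α > 5 / 3`.
  · nlinarith [sq_nonneg (2 * y + (α - 1))]

/-! ### Weighted bounds for sums of path counts -/

/-- Weights `c k` such that the `k` largest path counts sum up to at most a multiple of `c k`. -/
noncomputable def tribonacciWeight (α : ℝ) : ℕ → ℝ
  | 0 => 0
  | 1 => 1
  | 2 => α ^ 2 - α
  | 3 => α
  | 4 => α * (109 / 100)
  | 5 => 43 / 20
  | _ + 6 => 23 / 10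

theorem tribonacciWeight_le {α : ℝ} (h1 : (1.8392 : ℝ) < α) (h2 : α < (1.8393 : ℝ)) (k : ℕ) :
    0 ≤ tribonacciWeight α k ∧ tribonacciWeight α k ≤ 23 / 10 := by
  norm_num at h1 h2
  match k with
  | 0 => norm_num [tribonacciWeight]
  | 1 => norm_num [tribonacciWeight]
  | 2 => constructor <;> simp only [tribonacciWeight] <;> nlinarith
  | 3 => constructor <;> simp only [tribonacciWeight] <;> linarith
  | 4 => constructor <;> simp only [tribonacciWeight] <;> linarith
  | 5 => norm_num [tribonacciWeight]
  | _ + 6 => norm_num [tribonacciWeight]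

/-- This is the inductive step for adding a vertex of out-degree `d` to a `k`-set. For `d = 3` and
`k = 0, 1, 2` it is an equality, which is where the cubic equation enters; `c 4` makes `d = 4`, `k =
0` tight. The remaining weights are rounded numbers with some slack. -/
theorem tribonacciWeight_add_le {α : ℝ} (h0 : α ^ 3 - α ^ 2 - α - 1 = 0)
    (h1 : (1.8392 : ℝ) < α) (h2 : α < (1.8393 : ℝ)) (d k : ℕ) :
    tribonacciWeight α d + tribonacciWeight α k ≤
      tribonacciWeight α (k + 1) * (α / (109 / 100) ^ 3 * (109 / 100) ^ d) := by
  norm_num at h1 h2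
  have hsq1 : (18392 / 10000) * α ≤ α ^ 2 := by nlinarith
  have hsq2 : α ^ 2 ≤ (18393 / 10000) * α := by nlinarith
  have hcu : α ^ 2 * α = α ^ 2 + α + 1 := by linarith
  have key : ∀ d : ℕ, d ≤ 6 → tribonacciWeight α d + tribonacciWeight α k ≤
      tribonacciWeight α (k + 1) * (α / (109 / 100) ^ 3 * (109 / 100) ^ d) := by
    intro d hd
    interval_cases d <;>
    match k with
    | 0 | 1 | 2 | 3 | 4 | 5 | _ + 6 =>
      simp only [tribonacciWeight]
      norm_num <;> nlinarith
  rcases le_total d 6 with hd | hd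
  · exact key d hd
  -- The weights are constant from 6 on, while the right-hand side grows with `d`.
  · obtain ⟨j, rfl⟩ := Nat.exists_eq_add_of_le' hd
    refine (key 6 le_rfl).trans ?_
    have := (tribonacciWeight_le (by norm_num; linarith : (1.8392 : ℝ) < α)
      (by norm_num; linarith : α < (1.8393 : ℝ)) (k + 1)).1
    have : (109 / 100 : ℝ) ^ 6 ≤ (109 / 100) ^ (j + 6) :=
      pow_le_pow_right₀ (by norm_num) (by omega)
    gcongr

open Classical in
/-- Suppose that `g` is bounded at each vertex of `S` by the sum of its values over the
out-neighbours in `insert t S`. Then sums of `g` are bounded in terms of the number of edges. -/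
theorem sum_le_of_superharmonic {α : ℝ} (h0 : α ^ 3 - α ^ 2 - α - 1 = 0)
    (h1 : (1.8392 : ℝ) < α) (h2 : α < (1.8393 : ℝ))
    {V K : Type*} [LinearOrder K] (key : V → K) (R : V → V → Prop)
    (hR : ∀ a b, R a b → key a < key b) (S : Finset V) (t : V) (g : V → ℝ) (ht : g t ≤ 1)
    (hg : ∀ a ∈ S, g a ≤ ∑ u ∈ insert t S with R a u, g u)
    (W : Finset V) : W ⊆ S → (∀ v ∈ W, ∀ u ∈ insert t S, R v u → u ∈ insert t W) →
      ∀ A ⊆ insert t W, ∑ v ∈ A, g v ≤ tribonacciWeight α A.card *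
        ((α / (109 / 100) ^ 3) ^ W.card *
          (109 / 100) ^ (∑ v ∈ W, {u ∈ insert t S | R v u}.card)) := by
  have hα : 1 ≤ α / (109 / 100) ^ 3 := by norm_num at h1 ⊢; linarith
  -- Each new vertex `a` precedes all of `W`, so its out-neighbours lie in `insert t W` and the
  -- bound for `W` applies to them.
  refine Finset.induction_on_min_value key W ?_ ?_
  · intro _ _ A hA
    rcases Finset.subset_singleton_iff.1 (show A ⊆ {t} by simpa using hA) with rfl | rfl
    · simp [tribonacciWeight]
    · simpa [tribonacciWeight] using ht
  · intro a W ha hmin ih hWS hup A hA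
    have hup' : ∀ v ∈ W, ∀ u ∈ insert t S, R v u → u ∈ insert t W := by
      intro v hv u hu hvu
      have h := hup v (Finset.mem_insert_of_mem hv) u hu hvu
      have hne : u ≠ a := by
        rintro rfl
        exact absurd (hR _ _ hvu) (not_lt.2 (hmin v hv))
      simp only [Finset.mem_insert] at h ⊢
      tauto
    have ih := ih ((Finset.subset_insert _ _).trans hWS) hup'
    rw [Finset.card_insert_of_notMem ha, Finset.sum_insert ha, pow_succ, pow_add]
    set M := (α / (109 / 100) ^ 3) ^ W.card *
          (109 / 100) ^ (∑ v ∈ W, {u ∈ insert t S | R v u}.card) with hM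
    have hMpos : 0 ≤ M := by positivity
    set d := {u ∈ insert t S | R a u}.card with hd
    have hrw : (α / (109 / 100) ^ 3) ^ W.card * (α / (109 / 100) ^ 3) * ((109 / 100) ^ d *
        (109 / 100) ^ (∑ v ∈ W, {u ∈ insert t S | R v u}.card)) =
        (α / (109 / 100) ^ 3 * (109 / 100) ^ d) * M := by rw [hM]; ring
    rw [hrw]
    by_cases haA : a ∈ A
    · have hA' : A.erase a ⊆ insert t W := by
        intro v hv
        obtain ⟨hva, hvA⟩ := Finset.mem_erase.1 hv
        have := hA hvA
        simp only [Finset.mem_insert] at this ⊢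
        tauto
      have e1 := ih _ hA'
      have e2 : g a ≤ tribonacciWeight α d * M := by
        refine (hg a (hWS (Finset.mem_insert_self _ _))).trans (ih _ ?_)
        intro u hu
        obtain ⟨hu1, hu2⟩ := Finset.mem_filter.1 hu
        have h := hup a (Finset.mem_insert_self _ _) u hu1 hu2
        have hne : u ≠ a := by
          rintro rfl
          exact absurd (hR _ _ hu2) (lt_irrefl _)
        simp only [Finset.mem_insert] at h ⊢
        tauto
      have e3 := tribonacciWeight_add_le h0 h1 h2 d (A.erase a).card
      rw [Finset.card_erase_add_one haA] at e3
      rw [← Finset.add_sum_erase _ _ haA]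
      calc _ ≤ (tribonacciWeight α d + tribonacciWeight α (A.erase a).card) * M := by linarith
        _ ≤ _ := (mul_le_mul_of_nonneg_right e3 hMpos).trans_eq (mul_assoc _ _ _)
    · have hA' : A ⊆ insert t W := by
        intro v hv
        have := hA hv
        have hne : v ≠ a := by rintro rfl; exact haA hv
        simp only [Finset.mem_insert] at this ⊢
        tauto
      -- If `a` is not in `A`, the sum is unchanged and the bound only grows, its new factor being
      -- at least 1.
      refine (ih _ hA').trans ?_
      have hc := (tribonacciWeight_le h1 h2 A.card).1
      have : 1 ≤ α / (109 / 100) ^ 3 * (109 / 100) ^ d :=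
        one_le_mul_of_one_le_of_one_le hα (one_le_pow₀ (by norm_num))
      have := mul_le_mul_of_nonneg_right this hMpos
      rw [one_mul] at this
      gcongr

/-! ### Directed paths in sparse acyclic digraphs -/

/-- The directed paths from `v` to `t`, with the first vertex `v` omitted. -/
def chainsBetween {V : Type*} (R : V → V → Prop) (v t : V) : Set (List V) :=
  {l | (v :: l).IsChain R ∧ (v :: l).getLast (List.cons_ne_nil _ _) = t}

section Chains

variable {V K : Type*} [LinearOrder K] {key : V → K} {R : V → V → Prop}

theorem pairwise_of_isChain (hR : ∀ a b, R a b → key a < key b) {l : List V}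
    (hl : l.IsChain R) : l.Pairwise fun a b => key a < key b := by
  have : Trans (fun a b => key a < key b) (fun a b => key a < key b)
      (fun a b : V => key a < key b) := ⟨fun h h' => lt_trans h h'⟩
  exact (hl.imp hR).pairwise

theorem finite_isChain [Fintype V] (hR : ∀ a b, R a b → key a < key b) :
    {l : List V | l.IsChain R}.Finite := by
  classical
  have hfin : {l : List V | l.Nodup}.Finite :=
    Set.finite_coe_iff.1 (inferInstanceAs (Finite {l : List V // l.Nodup}))
  refine hfin.subset fun l hl => ?_
  exact (pairwise_of_isChain hR hl).imp fun h => by rintro rfl; exact lt_irrefl _ h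

theorem finite_chainsBetween [Fintype V] (hR : ∀ a b, R a b → key a < key b) (v t : V) :
    (chainsBetween R v t).Finite :=
  Set.Finite.preimage (List.cons_injective.injOn) ((finite_isChain hR).subset fun _ h => h)
    |>.subset (fun l hl => show v :: l ∈ {l : List V | l.IsChain R} from hl.1)

theorem chainsBetween_key (hR : ∀ a b, R a b → key a < key b) {v t : V} {l : List V}
    (hl : l ∈ chainsBetween R v t) : (l = [] ∧ v = t) ∨ (l ≠ [] ∧ key v < key t) := by
  rcases l with _ | ⟨u, l⟩
  · exact Or.inl ⟨rfl, hl.2⟩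
  · right
    refine ⟨List.cons_ne_nil _ _, ?_⟩
    refine List.rel_of_pairwise_cons (pairwise_of_isChain hR hl.1) ?_
    have := hl.2
    rw [List.getLast_cons (List.cons_ne_nil _ _)] at this
    rw [← this]
    exact List.getLast_mem _

-- Split off the second vertex of the path. It is `t` or has smaller key than `t`, so it lies in
-- `insert t S`.
open Classical in
theorem ncard_chainsBetween_le [Fintype V] (hR : ∀ a b, R a b → key a < key b) {v t : V}
    (hvt : v ≠ t) (S : Finset V) (hS : ∀ u, key u < key t → u ∈ S) :
    (chainsBetween R v t).ncard ≤
      ∑ u ∈ insert t S with R v u, (chainsBetween R u t).ncard := by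
  have hsub : chainsBetween R v t ⊆
      ⋃ u ∈ {u ∈ insert t S | R v u}, List.cons u '' chainsBetween R u t := by
    intro l hl
    rcases l with _ | ⟨u, l⟩
    · exact absurd hl.2 hvt
    · have hl' : l ∈ chainsBetween R u t :=
        ⟨hl.1.tail, by have := hl.2; rwa [List.getLast_cons (List.cons_ne_nil _ _)] at this⟩
      simp only [Set.mem_iUnion]
      refine ⟨u, ?_, l, hl', rfl⟩
      simp only [Finset.mem_filter, Finset.mem_insert]
      refine ⟨?_, (List.isChain_cons_cons.1 hl.1).1⟩
      rcases chainsBetween_key hR hl' with h | h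
      · exact Or.inl h.2
      · exact Or.inr (hS _ h.2)
  refine (Set.ncard_le_ncard hsub ?_).trans ((Finset.set_ncard_biUnion_le _ _).trans ?_)
  · exact Set.Finite.biUnion (Finset.finite_toSet _)
      fun u _ => (finite_chainsBetween hR u t).image _
  · exact Finset.sum_le_sum fun u _ => Set.ncard_image_le (finite_chainsBetween hR u t)

open Classical in
/-- If every set `U` of vertices of an acyclic digraph spans at most `3 |U|` edges, then the
digraph has `O(α ^ n)` directed paths. -/
theorem ncard_isChain_le {α : ℝ} (h0 : α ^ 3 - α ^ 2 - α - 1 = 0)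
    (h1 : (1.8392 : ℝ) < α) (h2 : α < (1.8393 : ℝ)) [Fintype V]
    (hkey : Function.Injective key) (hR : ∀ a b, R a b → key a < key b)
    (hE : ∀ U : Finset V, {p ∈ U ×ˢ U | R p.1 p.2}.card ≤ 3 * U.card) :
    {l : List V | l ≠ [] ∧ l.IsChain R}.Finite ∧
      ({l : List V | l ≠ [] ∧ l.IsChain R}.ncard : ℝ) ≤ 6 * α ^ Fintype.card V := by
  refine ⟨(finite_isChain hR).subset fun l hl => hl.2, ?_⟩
  set S : V → Finset V := fun t => {v | key v < key t} with hS
  have hsub : {l : List V | l ≠ [] ∧ l.IsChain R} ⊆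
      ⋃ t ∈ (Finset.univ : Finset V), ⋃ v ∈ insert t (S t),
        List.cons v '' chainsBetween R v t := by
    rintro l ⟨hne, hl⟩
    obtain ⟨v, l, rfl⟩ := List.exists_cons_of_ne_nil hne
    simp only [Set.mem_iUnion]
    have hmem : l ∈ chainsBetween R v ((v :: l).getLast hne) := ⟨hl, rfl⟩
    refine ⟨(v :: l).getLast hne, Finset.mem_univ _, v, ?_, l, hmem, rfl⟩
    rcases chainsBetween_key hR hmem with h | h
    · exact Finset.mem_insert.2 (Or.inl h.2)
    · exact Finset.mem_insert_of_mem (by simpa [hS] using h.2)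
  have hfin : ∀ t, (⋃ v ∈ insert t (S t), List.cons v '' chainsBetween R v t).Finite :=
    fun t => Set.Finite.biUnion (Finset.finite_toSet _)
      fun u _ => (finite_chainsBetween hR u t).image _
  have hcount : {l : List V | l ≠ [] ∧ l.IsChain R}.ncard ≤
      ∑ t, ∑ v ∈ insert t (S t), (chainsBetween R v t).ncard := by
    refine (Set.ncard_le_ncard hsub (Set.Finite.biUnion (Finset.finite_toSet _)
      fun t _ => hfin t)).trans ((Finset.set_ncard_biUnion_le _ _).trans ?_)
    refine Finset.sum_le_sum fun t _ => (Finset.set_ncard_biUnion_le _ _).trans ?_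
    exact Finset.sum_le_sum fun u _ => Set.ncard_image_le (finite_chainsBetween hR u t)
  have hpos : 0 < α := by norm_num at h1; linarith
  have hend : ∀ t, ∑ v ∈ insert t (S t), ((chainsBetween R v t).ncard : ℝ) ≤
      3 * α ^ (S t).card := by
    intro t
    have ht : t ∉ S t := by simp [hS]
    have hb := sum_le_of_superharmonic h0 h1 h2 key R hR (S t) t
      (fun v => ((chainsBetween R v t).ncard : ℝ)) ?_ ?_ (S t) subset_rfl (fun _ _ u hu _ => hu)
      _ subset_rfl
    · refine hb.trans ?_
      -- Sparsity is applied to `S t` together with `t`; the extra vertex accounts for the `+ 3`.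
      have he : ∑ v ∈ S t, {u ∈ insert t (S t) | R v u}.card ≤ 3 * (S t).card + 3 := by
        have := hE (insert t (S t))
        rw [Finset.card_insert_of_notMem ht] at this
        refine le_trans ?_ this
        rw [← Finset.card_sigma]
        refine Finset.card_le_card_of_injOn (fun p => (p.1, p.2)) ?_ ?_
        · rintro ⟨a, b⟩ hab
          simp only [Finset.coe_sigma, Set.mem_sigma_iff, Finset.mem_coe, Finset.mem_filter] at hab
          simp only [Finset.mem_coe, Finset.mem_filter, Finset.mem_product]
          exact ⟨⟨Finset.mem_insert_of_mem hab.1, hab.2.1⟩, hab.2.2⟩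
        · rintro ⟨a, b⟩ _ ⟨a', b'⟩ _ h
          simpa using h
      have hp : ((109 / 100 : ℝ)) ^ (∑ v ∈ S t, {u ∈ insert t (S t) | R v u}.card) ≤
          (109 / 100) ^ (3 * (S t).card + 3) := pow_le_pow_right₀ (by norm_num) he
      have hc := tribonacciWeight_le h1 h2 (insert t (S t)).card
      calc _ ≤ (23 / 10) * ((α / (109 / 100) ^ 3) ^ (S t).card *
            (109 / 100) ^ (3 * (S t).card + 3)) := by gcongr; exact hc.2
        _ = (23 / 10) * (109 / 100) ^ 3 * α ^ (S t).card := by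
          rw [div_pow, pow_add, pow_mul]
          field_simp
        _ ≤ _ := by gcongr; norm_num
    · have : chainsBetween R t t ⊆ {[]} := by
        intro l hl
        rcases chainsBetween_key hR hl with h | h
        · exact h.1
        · exact absurd h.2 (lt_irrefl _)
      have := Set.ncard_le_ncard this
      rw [Set.ncard_singleton] at this
      exact_mod_cast this
    · intro a ha
      have hat : a ≠ t := by rintro rfl; exact ht ha
      exact_mod_cast ncard_chainsBetween_le hR hat (S t) (fun u hu => by simpa [hS] using hu)
  -- The sizes `(S t).card` are the distinct ranks of the vertices, so summing over the last vertex
  -- gives a geometric sum.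
  have hinj : Set.InjOn (fun t => (S t).card) (Finset.univ : Finset V) := by
    have hlt : ∀ s t, key s < key t → (S s).card < (S t).card := by
      intro s t hst
      refine Finset.card_lt_card (Finset.ssubset_iff_of_subset ?_ |>.2 ⟨s, ?_, ?_⟩)
      · intro v hv
        simp only [hS, Finset.mem_filter, Finset.mem_univ, true_and] at hv ⊢
        exact hv.trans hst
      · simpa [hS] using hst
      · simp [hS]
    intro s _ t _ hst
    have hst : (S s).card = (S t).card := hst
    apply hkey
    rcases lt_trichotomy (key s) (key t) with h | h | h
    · exact absurd hst (hlt _ _ h).ne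
    · exact h
    · exact absurd hst (hlt _ _ h).ne'
  have hlast : ∑ t : V, α ^ (S t).card ≤ 2 * α ^ Fintype.card V := by
    rw [← Finset.sum_image (f := fun j => α ^ j) hinj]
    have hsubset : Finset.univ.image (fun t => (S t).card) ⊆ Finset.range (Fintype.card V) := by
      intro j hj
      obtain ⟨t, -, rfl⟩ := Finset.mem_image.1 hj
      rw [Finset.mem_range]
      exact Finset.card_lt_univ_of_notMem (x := t) (by simp [hS])
    refine (Finset.sum_le_sum_of_subset_of_nonneg hsubset fun _ _ _ => by positivity).trans ?_
    have hα1 : α ≠ 1 := by rintro rfl; norm_num at h1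
    rw [geom_sum_eq hα1, div_le_iff₀ (by norm_num at h1; linarith)]
    have := pow_pos hpos (Fintype.card V)
    norm_num at h1
    nlinarith
  calc _ ≤ ((∑ t, ∑ v ∈ insert t (S t), (chainsBetween R v t).ncard : ℕ) : ℝ) := by
        exact_mod_cast hcount
    _ ≤ ∑ t : V, 3 * α ^ (S t).card := by
        push_cast
        exact Finset.sum_le_sum fun t _ => hend t
    _ ≤ _ := by rw [← Finset.mul_sum]; linarith

end Chains

/-! ### Edge bound for monotone drawings -/

/-- A drawing of a directed graph `R` without crossings: the vertex `v` is the point `(X v, Y v)`,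
every edge leads from left to right, and the edge from `a` to `b` is the graph of the function
`F a b` over the interval `[X a, X b]`. -/
structure IsMonotoneDrawing {V : Type*} (X Y : V → ℝ) (R : V → V → Prop)
    (F : V → V → ℝ → ℝ) : Prop where
  lt : ∀ a b, R a b → X a < X b
  continuousOn : ∀ a b, R a b → ContinuousOn (F a b) (Set.Icc (X a) (X b))
  left : ∀ a b, R a b → F a b (X a) = Y a
  right : ∀ a b, R a b → F a b (X b) = Y b
  vertex : ∀ a b, R a b → ∀ v, X v ∈ Set.Icc (X a) (X b) → F a b (X v) = Y v → v = a ∨ v = b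
  disjoint : ∀ a b c d, R a b → R c d → (a, b) ≠ (c, d) → ∀ x ∈ Set.Icc (X a) (X b),
    x ∈ Set.Icc (X c) (X d) → F a b x = F c d x →
      ∃ v, (v = a ∨ v = b) ∧ (v = c ∨ v = d) ∧ X v = x

namespace IsMonotoneDrawing

variable {V : Type*} {X Y : V → ℝ} {R : V → V → Prop} {F : V → V → ℝ → ℝ}

/-- The reflection of a drawing in the horizontal axis. -/
theorem neg (h : IsMonotoneDrawing X Y R F) :
    IsMonotoneDrawing X (fun v => -Y v) R (fun a b x => -F a b x) where
  lt := h.lt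
  continuousOn a b hab := (h.continuousOn a b hab).neg
  left a b hab := by rw [h.left a b hab]
  right a b hab := by rw [h.right a b hab]
  vertex a b hab v hv he := h.vertex a b hab v hv (neg_injective he)
  disjoint a b c d hab hcd hne x hx hx' he :=
    h.disjoint a b c d hab hcd hne x hx hx' (neg_injective he)

/-- The restriction of a drawing to a set of vertices. -/
theorem restrict (h : IsMonotoneDrawing X Y R F) (U : Set V) :
    IsMonotoneDrawing (fun v : U => X v) (fun v : U => Y v) (fun a b => R a b)
      (fun a b => F a b) where
  lt a b := h.lt a b
  continuousOn a b := h.continuousOn a b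
  left a b := h.left a b
  right a b := h.right a b
  vertex a b hab v hv he := by
    simpa only [Subtype.ext_iff] using h.vertex a b hab v hv he
  disjoint a b c d hab hcd hne x hx hx' he := by
    have hne' : ((a : V), (b : V)) ≠ ((c : V), (d : V)) := by
      simpa only [ne_eq, Prod.mk.injEq, Subtype.ext_iff] using hne
    obtain ⟨v, h1, h2, h3⟩ := h.disjoint a b c d hab hcd hne' x hx hx' he
    have hv : v ∈ U := by rcases h1 with rfl | rfl <;> exact Subtype.property _
    exact ⟨⟨v, hv⟩, by simpa only [Subtype.ext_iff] using h1,
      by simpa only [Subtype.ext_iff] using h2, h3⟩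

/-- Two edges do not meet over an open interval in their common range. -/
theorem ne_of_mem_Ioo (h : IsMonotoneDrawing X Y R F) {a b c d : V} (hab : R a b) (hcd : R c d)
    (hne : (a, b) ≠ (c, d)) {x : ℝ} (hx : x ∈ Set.Ioo (X a) (X b))
    (hx' : x ∈ Set.Icc (X c) (X d)) : F a b x ≠ F c d x := by
  intro he
  obtain ⟨v, h1, -, h3⟩ := h.disjoint a b c d hab hcd hne x (Set.Ioo_subset_Icc_self hx) hx' he
  rcases h1 with rfl | rfl
  · exact hx.1.ne h3
  · exact hx.2.ne' h3

/-- The vertical order of two edges is constant over an open interval in their common range. -/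
theorem lt_of_lt (h : IsMonotoneDrawing X Y R F) {a b c d : V} (hab : R a b) (hcd : R c d)
    {x y l r : ℝ} (hl : X a ≤ l) (hl' : X c ≤ l) (hr : r ≤ X b) (hr' : r ≤ X d)
    (hx : x ∈ Set.Icc l r) (hy : y ∈ Set.Ioo l r)
    (hlt : F a b x < F c d x) : F a b y < F c d y := by
  have hne : (a, b) ≠ (c, d) := by
    intro he
    simp only [Prod.mk.injEq] at he
    obtain ⟨rfl, rfl⟩ := he
    exact lt_irrefl _ hlt
  by_contra hcon
  have hcon := not_lt.1 hcon
  have hsub : Set.uIcc x y ⊆ Set.Icc l r :=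
    Set.uIcc_subset_Icc hx (Set.Ioo_subset_Icc_self hy)
  have hc : ContinuousOn (fun z => F a b z - F c d z) (Set.uIcc x y) :=
    ((h.continuousOn a b hab).mono (hsub.trans (Set.Icc_subset_Icc hl hr))).sub
      ((h.continuousOn c d hcd).mono (hsub.trans (Set.Icc_subset_Icc hl' hr')))
  obtain ⟨z, hz, hz0⟩ := intermediate_value_uIcc hc
    (show (0 : ℝ) ∈ Set.uIcc _ _ from Set.mem_uIcc.2 (Or.inl ⟨by linarith, by linarith⟩))
  have hz0 : F a b z = F c d z := sub_eq_zero.1 hz0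
  have hzx : z ≠ x := by rintro rfl; exact hlt.ne hz0
  have hzl : l < z ∧ z < r := by
    rcases Set.mem_uIcc.1 hz with h' | h'
    · exact ⟨lt_of_le_of_lt hx.1 (lt_of_le_of_ne h'.1 hzx.symm), lt_of_le_of_lt h'.2 hy.2⟩
    · exact ⟨lt_of_lt_of_le hy.1 h'.1, lt_of_lt_of_le (lt_of_le_of_ne h'.2 hzx) hx.2⟩
  exact h.ne_of_mem_Ioo hab hcd hne ⟨hl.trans_lt hzl.1, hzl.2.trans_le hr⟩
    ⟨hl'.trans hzl.1.le, hzl.2.le.trans hr'⟩ hz0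

/-- Weak version of `lt_of_lt` at the endpoints of the common range. -/
theorem le_of_lt (h : IsMonotoneDrawing X Y R F) {a b c d : V} (hab : R a b) (hcd : R c d)
    {x y l r : ℝ} (hl : X a ≤ l) (hl' : X c ≤ l) (hr : r ≤ X b) (hr' : r ≤ X d)
    (hx : x ∈ Set.Icc l r) (hy : y ∈ Set.Icc l r) (hlr : l < r)
    (hlt : F a b x < F c d x) : F a b y ≤ F c d y := by
  have hcl : closure (Set.Ioo l r) = Set.Icc l r := closure_Ioo hlr.ne
  have hc := (h.continuousOn a b hab).mono (Set.Icc_subset_Icc hl hr)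
  have hc' := (h.continuousOn c d hcd).mono (Set.Icc_subset_Icc hl' hr')
  rw [← hcl] at hc hc' hy
  exact le_on_closure (fun z hz => (h.lt_of_lt hab hcd hl hl' hr hr' hx hz hlt).le) hc hc' hy

/-- The edge from `c` to `v` is below the edge from `a` to `v`. -/
def Below (X : V → ℝ) (R : V → V → Prop) (F : V → V → ℝ → ℝ) (c a v : V) : Prop :=
  R c v ∧ R a v ∧ ∀ x ∈ Set.Ioo (max (X c) (X a)) (X v), F c v x < F a v x

theorem below_of_lt (h : IsMonotoneDrawing X Y R F) {c a v : V} (hc : R c v) (ha : R a v)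
    {x : ℝ} (hx : x ∈ Set.Icc (max (X c) (X a)) (X v)) (hlt : F c v x < F a v x) :
    Below X R F c a v :=
  ⟨hc, ha, fun _ hy => h.lt_of_lt hc ha (le_max_left _ _) (le_max_right _ _) le_rfl le_rfl hx hy
    hlt⟩

theorem exists_mem_Ioo (h : IsMonotoneDrawing X Y R F) {c a v : V} (hc : R c v) (ha : R a v) :
    ((max (X c) (X a)) + X v) / 2 ∈ Set.Ioo (max (X c) (X a)) (X v) := by
  have := max_lt (h.lt _ _ hc) (h.lt _ _ ha)
  constructor <;> linarith

theorem below_total (h : IsMonotoneDrawing X Y R F) {c a v : V} (hc : R c v) (ha : R a v)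
    (hne : c ≠ a) : Below X R F c a v ∨ Below X R F a c v := by
  have hm := h.exists_mem_Ioo hc ha
  set m := ((max (X c) (X a)) + X v) / 2
  have hmc : X c < m := (le_max_left _ _).trans_lt hm.1
  have hma : X a < m := (le_max_right _ _).trans_lt hm.1
  rcases lt_or_gt_of_ne (h.ne_of_mem_Ioo hc ha (by simpa using hne) ⟨hmc, hm.2⟩
    ⟨hma.le, hm.2.le⟩) with hlt | hlt
  · exact Or.inl (h.below_of_lt hc ha (Set.Ioo_subset_Icc_self hm) hlt)
  · rw [max_comm] at hm
    exact Or.inr (h.below_of_lt ha hc (Set.Ioo_subset_Icc_self hm) hlt)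

theorem Below.neg {c a v : V} (hb : Below X R F c a v) :
    Below X R (fun a b x => -F a b x) a c v :=
  ⟨hb.2.1, hb.1, fun x hx => neg_lt_neg (hb.2.2 x (by rwa [max_comm]))⟩

theorem below_neg_iff {c a v : V} :
    Below X R (fun a b x => -F a b x) c a v ↔ Below X R F a c v := by
  refine ⟨fun hb => ?_, Below.neg⟩
  have := hb.neg
  simpa only [neg_neg] using this

theorem Below.ne (h : IsMonotoneDrawing X Y R F) {c a v : V} (hb : Below X R F c a v) :
    c ≠ a := by
  rintro rfl
  exact lt_irrefl _ (hb.2.2 _ (h.exists_mem_Ioo hb.1 hb.2.1))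

/-- `Below` is transitive among the edges into `v`. -/
theorem Below.trans (h : IsMonotoneDrawing X Y R F) {c d a v : V} (h1 : Below X R F c d v)
    (h2 : Below X R F d a v) : Below X R F c a v := by
  have hlt := max_lt (h.lt _ _ h1.1) (max_lt (h.lt _ _ h1.2.1) (h.lt _ _ h2.2.1))
  obtain ⟨x, hx1, hx2⟩ := exists_between hlt
  simp only [max_lt_iff] at hx1
  exact h.below_of_lt h1.1 h2.2.1 ⟨max_le hx1.1.le hx1.2.2.le, hx2.le⟩
    ((h1.2.2 x ⟨max_lt hx1.1 hx1.2.1, hx2⟩).trans (h2.2.2 x ⟨max_lt hx1.2.1 hx1.2.2, hx2⟩))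

/-- The edges from `c` and from `a` are consecutive among the edges into `v` from the left. -/
def Consecutive (X : V → ℝ) (R : V → V → Prop) (F : V → V → ℝ → ℝ) (c a v : V) : Prop :=
  Below X R F c a v ∧ ∀ d, Below X R F c d v → ¬ Below X R F d a v

theorem consecutive_neg_iff {c a v : V} :
    Consecutive X R (fun a b x => -F a b x) c a v ↔ Consecutive X R F a c v := by
  simp only [Consecutive, below_neg_iff]
  exact and_congr_right fun _ => forall_congr' fun _ => not_imp_not.symm.trans
    (by simp only [not_not])

/-- The vertex `w` lies in the wedge between the edges from `c` and from `a` to `v`. -/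
def InWedge (X Y : V → ℝ) (F : V → V → ℝ → ℝ) (c a v w : V) : Prop :=
  X w ∈ Set.Ico (max (X c) (X a)) (X v) ∧ F c v (X w) ≤ Y w ∧ Y w ≤ F a v (X w)

/-- The vertex `w` is a rightmost vertex of the wedge and lies strictly below its upper side. -/
def IsApex (X Y : V → ℝ) (F : V → V → ℝ → ℝ) (c a v w : V) : Prop :=
  InWedge X Y F c a v w ∧ (∀ u, InWedge X Y F c a v u → X u ≤ X w) ∧ Y w < F a v (X w)

theorem inWedge_neg_iff {c a v w : V} :
    InWedge X (fun v => -Y v) (fun a b x => -F a b x) c a v w ↔ InWedge X Y F a c v w := by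
  simp only [InWedge, neg_le_neg_iff, max_comm (X c) (X a)]
  tauto

/-- The left endpoint with the larger `X` is such a vertex: it lies on one side, and the vertical
order of the two sides persists weakly up to it. -/
theorem Below.exists_inWedge (h : IsMonotoneDrawing X Y R F) {c a v : V}
    (hb : Below X R F c a v) : ∃ w, InWedge X Y F c a v w := by
  have hm := h.exists_mem_Ioo hb.1 hb.2.1
  have hlt := max_lt (h.lt _ _ hb.1) (h.lt _ _ hb.2.1)
  have hle : F c v (max (X c) (X a)) ≤ F a v (max (X c) (X a)) :=
    h.le_of_lt hb.1 hb.2.1 (le_max_left _ _) (le_max_right _ _) le_rfl le_rfl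
      (Set.Ioo_subset_Icc_self hm) ⟨le_rfl, hlt.le⟩ hlt (hb.2.2 _ hm)
  rcases le_total (X c) (X a) with hca | hca
  · rw [max_eq_right hca, h.left _ _ hb.2.1] at hle
    exact ⟨a, ⟨max_le hca le_rfl, h.lt _ _ hb.2.1⟩, hle, (h.left _ _ hb.2.1).ge⟩
  · rw [max_eq_left hca, h.left _ _ hb.1] at hle
    exact ⟨c, ⟨max_le le_rfl hca, h.lt _ _ hb.1⟩, (h.left _ _ hb.1).le, hle⟩

/-- A rightmost vertex of the wedge cannot lie on both sides, since it would then be the left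
endpoint of both edges. -/
theorem exists_isApex [Finite V] (h : IsMonotoneDrawing X Y R F) {c a v : V}
    (hb : Below X R F c a v) : ∃ w, IsApex X Y F c a v w ∨
      IsApex X (fun v => -Y v) (fun a b x => -F a b x) a c v w := by
  obtain ⟨w, hw, hmax⟩ := Set.exists_max_image {w | InWedge X Y F c a v w} X (Set.toFinite _)
    (hb.exists_inWedge h)
  refine ⟨w, ?_⟩
  rcases lt_or_eq_of_le hw.2.2 with hlt | heq
  · exact Or.inl ⟨hw, hmax, hlt⟩
  · rcases lt_or_eq_of_le hw.2.1 with hlt | heq'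
    · exact Or.inr ⟨inWedge_neg_iff.2 hw, fun u hu => hmax u (inWedge_neg_iff.1 hu),
        neg_lt_neg hlt⟩
    · exfalso
      have hwc := h.vertex _ _ hb.1 w ⟨(le_max_left _ _).trans hw.1.1, hw.1.2.le⟩ heq'
      have hwa := h.vertex _ _ hb.2.1 w ⟨(le_max_right _ _).trans hw.1.1, hw.1.2.le⟩ heq.symm
      have hwv : w ≠ v := by rintro rfl; exact lt_irrefl _ hw.1.2
      exact hb.ne h ((hwc.resolve_right hwv).symm.trans (hwa.resolve_right hwv))

/-- Two wedges with the same apex have the same upper side: otherwise the higher wedge would contain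
the right vertex of the lower one, or an edge between two consecutive edges. -/
theorem not_isApex_of_lt (h : IsMonotoneDrawing X Y R F) {c a v c' a' v' w : V}
    (hb : Below X R F c a v) (hb' : Consecutive X R F c' a' v')
    (hw : IsApex X Y F c a v w) (hw' : IsApex X Y F c' a' v' w) {x : ℝ}
    (hx : x ∈ Set.Ioo (X w) (min (X v) (X v'))) (hlt : F a v x < F a' v' x) : False := by
  obtain ⟨⟨⟨hw1, hw2⟩, hw3, hw4⟩, hwm, hw5⟩ := hw
  obtain ⟨⟨⟨hw1', hw2'⟩, hw3', hw4'⟩, hwm', hw5'⟩ := hw'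
  have hxa : X a ≤ X w := (le_max_right _ _).trans hw1
  have hxa' : X a' ≤ X w := (le_max_right _ _).trans hw1'
  have hxc' : X c' ≤ X w := (le_max_left _ _).trans hw1'
  have hRa := hb.2.1
  have hRa' := hb'.1.2.1
  have hRc' := hb'.1.1
  have hmin : X w < min (X v) (X v') := lt_min hw2 hw2'
  have hlow : F c' v' (X w) < F a v (X w) := hw3'.trans_lt hw5
  -- To the right of `w`, the edge `a v` is squeezed between the two sides of the other wedge.
  have key1 : ∀ y ∈ Set.Icc (X w) (min (X v) (X v')), F c' v' y ≤ F a v y := fun y hy =>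
    h.le_of_lt hRc' hRa hxc' hxa (min_le_right _ _) (min_le_left _ _) ⟨le_rfl, hmin.le⟩ hy hmin
      hlow
  have key2 : ∀ y ∈ Set.Icc (X w) (min (X v) (X v')), F a v y ≤ F a' v' y := fun y hy =>
    h.le_of_lt hRa hRa' hxa hxa' (min_le_left _ _) (min_le_right _ _)
      (Set.Ioo_subset_Icc_self hx) hy hmin hlt
  have hend : min (X v) (X v') ∈ Set.Icc (X w) (min (X v) (X v')) := ⟨hmin.le, le_rfl⟩
  have k1 := key1 _ hend
  have k2 := key2 _ hend
  -- If `a v` ends first, `v` lies in the other wedge to the right of `w`. Otherwise `v'` lies on `a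
  -- v`, hence `v' = v`, and `a v` separates two consecutive edges.
  rcases lt_or_ge (X v) (X v') with hvv | hvv
  · rw [min_eq_left hvv.le, h.right _ _ hRa] at k1 k2
    exact absurd (hwm' v ⟨⟨hw1'.trans hw2.le, hvv⟩, k1, k2⟩) (not_le.2 hw2)
  · rw [min_eq_right hvv] at k1 k2 hmin hx hend
    rw [h.right _ _ hRc'] at k1
    rw [h.right _ _ hRa'] at k2
    have heq : v' = a ∨ v' = v :=
      h.vertex _ _ hRa v' ⟨hxa.trans hw2'.le, hvv⟩ (le_antisymm k2 k1)
    rcases heq with rfl | rfl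
    · exact absurd hxa (not_le.2 hw2')
    · refine hb'.2 a ?_ ?_
      · exact h.below_of_lt hRc' hRa ⟨max_le hxc' hxa, hw2.le⟩ hlow
      · exact h.below_of_lt hRa hRa' ⟨max_le (hxa.trans hx.1.le) (hxa'.trans hx.1.le), hx.2.le⟩
          hlt

theorem eq_of_isApex (h : IsMonotoneDrawing X Y R F) {c a v c' a' v' w : V}
    (hb : Consecutive X R F c a v) (hb' : Consecutive X R F c' a' v')
    (hw : IsApex X Y F c a v w) (hw' : IsApex X Y F c' a' v' w) :
    c = c' ∧ a = a' ∧ v = v' := by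
  have hmin : X w < min (X v) (X v') := lt_min hw.1.1.2 hw'.1.1.2
  obtain ⟨x, hx1, hx2⟩ := exists_between hmin
  have hav : (a, v) = (a', v') := by
    by_contra hne
    have hxv := hx2.trans_le (min_le_left _ _)
    have hxv' := hx2.trans_le (min_le_right _ _)
    have hxa := ((le_max_right _ _).trans hw.1.1.1).trans_lt hx1
    have hxa' := ((le_max_right _ _).trans hw'.1.1.1).trans_lt hx1
    rcases lt_or_gt_of_ne (h.ne_of_mem_Ioo hb.1.2.1 hb'.1.2.1 hne ⟨hxa, hxv⟩ ⟨hxa'.le, hxv'.le⟩)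
      with hlt | hlt
    · exact h.not_isApex_of_lt hb.1 hb' hw hw' ⟨hx1, hx2⟩ hlt
    · exact h.not_isApex_of_lt hb'.1 hb hw' hw ⟨hx1, by rwa [min_comm]⟩ hlt
  simp only [Prod.mk.injEq] at hav
  obtain ⟨rfl, rfl⟩ := hav
  refine ⟨?_, rfl, rfl⟩
  by_contra hne
  rcases h.below_total hb.1.1 hb'.1.1 hne with hlt | hlt
  · exact hb.2 _ hlt hb'.1
  · exact hb'.2 _ hlt hb.1

-- Among the edges below `a v`, take one with the most edges beneath it.
open Classical in
theorem exists_consecutive [Finite V] (h : IsMonotoneDrawing X Y R F) {c a v : V}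
    (hb : Below X R F c a v) : ∃ d, Consecutive X R F d a v := by
  have := Fintype.ofFinite V
  set lower : V → Finset V := fun d => {e | Below X R F e d v}
  obtain ⟨d, hd, hmax⟩ := Set.exists_max_image {d | Below X R F d a v} (fun d => (lower d).card)
    (Set.toFinite _) ⟨c, hb⟩
  refine ⟨d, hd, fun e hde hea => ?_⟩
  have hss : lower d ⊂ lower e := by
    refine (Finset.ssubset_iff_of_subset ?_).2 ⟨d, ?_, ?_⟩
    · intro z hz
      simp only [lower, Finset.mem_filter, Finset.mem_univ, true_and] at hz ⊢
      exact hz.trans h hde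
    · simpa [lower] using hde
    · simp only [lower, Finset.mem_filter, Finset.mem_univ, true_and]
      exact fun hdd => hdd.ne h rfl
  exact absurd (hmax e hea) (not_le.2 (Finset.card_lt_card hss))

open Classical in
theorem card_isApex_le [Fintype V] (h : IsMonotoneDrawing X Y R F) :
    (Finset.univ.filter fun p : V × V × V => Consecutive X R F p.1 p.2.1 p.2.2 ∧
      ∃ w, IsApex X Y F p.1 p.2.1 p.2.2 w).card ≤ Fintype.card V := by
  refine Finset.card_le_card_of_forall_subsingleton
    (fun p w => IsApex X Y F p.1 p.2.1 p.2.2 w) (t := Finset.univ) ?_ ?_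
  · intro p hp
    obtain ⟨w, hw⟩ := (Finset.mem_filter.1 hp).2.2
    exact ⟨w, Finset.mem_univ _, hw⟩
  · rintro w - ⟨c, a, v⟩ ⟨hp, hw⟩ ⟨c', a', v'⟩ ⟨hp', hw'⟩
    obtain ⟨rfl, rfl, rfl⟩ :=
      h.eq_of_isApex (Finset.mem_filter.1 hp).2.1 (Finset.mem_filter.1 hp').2.1 hw hw'
    rfl

-- Reflection exchanges the two sides of a wedge, so one apex count covers both kinds of apex.
open Classical in
theorem card_consecutive_le [Fintype V] (h : IsMonotoneDrawing X Y R F) :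
    (Finset.univ.filter fun p : V × V × V => Consecutive X R F p.1 p.2.1 p.2.2).card ≤
      2 * Fintype.card V := by
  have hdown : (Finset.univ.filter fun p : V × V × V => Consecutive X R F p.1 p.2.1 p.2.2 ∧
      ∃ w, IsApex X (fun v => -Y v) (fun a b x => -F a b x) p.2.1 p.1 p.2.2 w).card ≤
        Fintype.card V := by
    refine le_trans ?_ h.neg.card_isApex_le
    refine Finset.card_le_card_of_injOn (fun p => (p.2.1, p.1, p.2.2)) ?_ ?_
    · rintro ⟨c, a, v⟩ hp
      simp only [Finset.coe_filter, Finset.mem_univ, true_and, Set.mem_ofPred_eq] at hp ⊢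
      exact ⟨consecutive_neg_iff.2 hp.1, hp.2⟩
    · rintro ⟨c, a, v⟩ - ⟨c', a', v'⟩ - he
      simp only [Prod.mk.injEq] at he ⊢
      tauto
  have hsub : (Finset.univ.filter fun p : V × V × V => Consecutive X R F p.1 p.2.1 p.2.2) ⊆
      (Finset.univ.filter fun p : V × V × V => Consecutive X R F p.1 p.2.1 p.2.2 ∧
        ∃ w, IsApex X Y F p.1 p.2.1 p.2.2 w) ∪
      (Finset.univ.filter fun p : V × V × V => Consecutive X R F p.1 p.2.1 p.2.2 ∧
      ∃ w, IsApex X (fun v => -Y v) (fun a b x => -F a b x) p.2.1 p.1 p.2.2 w) := by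
    rintro ⟨c, a, v⟩ hp
    simp only [Finset.mem_union, Finset.mem_filter, Finset.mem_univ, true_and] at hp ⊢
    obtain ⟨w, hw | hw⟩ := h.exists_isApex hp.1
    · exact Or.inl ⟨hp, w, hw⟩
    · exact Or.inr ⟨hp, w, hw⟩
  have := (Finset.card_le_card hsub).trans (Finset.card_union_le _ _)
  have := h.card_isApex_le
  omega

open Classical in
/-- A drawing on `n` vertices has at most `3 n` edges. -/
theorem card_edges_le [Fintype V] (h : IsMonotoneDrawing X Y R F) :
    (Finset.univ.filter fun p : V × V => R p.1 p.2).card ≤ 3 * Fintype.card V := by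
  -- Each vertex has at most one lowest incoming edge; all others are upper sides of consecutive
  -- pairs.
  have hlow : (Finset.univ.filter fun p : V × V =>
      R p.1 p.2 ∧ ∀ c, ¬ Below X R F c p.1 p.2).card ≤ Fintype.card V := by
    refine Finset.card_le_card_of_injOn (t := Finset.univ) Prod.snd (fun _ _ => Finset.mem_univ _) ?_
    rintro ⟨a, v⟩ ha ⟨a', v'⟩ ha' he
    simp only [Finset.coe_filter, Finset.mem_univ, true_and, Set.mem_ofPred_eq] at ha ha' he
    subst he
    by_contra hne
    rcases h.below_total ha.1 ha'.1 (by simpa using hne) with hb | hb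
    · exact ha'.2 _ hb
    · exact ha.2 _ hb
  have hsub : (Finset.univ.filter fun p : V × V => R p.1 p.2) ⊆
      (Finset.univ.filter fun p : V × V => R p.1 p.2 ∧ ∀ c, ¬ Below X R F c p.1 p.2) ∪
      (Finset.univ.filter fun p : V × V × V => Consecutive X R F p.1 p.2.1 p.2.2).image
        Prod.snd := by
    rintro ⟨a, v⟩ hp
    simp only [Finset.mem_union, Finset.mem_filter, Finset.mem_univ, true_and,
      Finset.mem_image] at hp ⊢
    by_cases hc : ∃ c, Below X R F c a v
    · obtain ⟨c, hc⟩ := hc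
      obtain ⟨d, hd⟩ := h.exists_consecutive hc
      exact Or.inr ⟨(d, a, v), hd, rfl⟩
    · exact Or.inl ⟨hp, not_exists.1 hc⟩
  have h1 := (Finset.card_le_card hsub).trans (Finset.card_union_le _ _)
  have h2 := h.card_consecutive_le
  have h3 := Finset.card_image_le (s := Finset.univ.filter fun p : V × V × V =>
    Consecutive X R F p.1 p.2.1 p.2.2) (f := Prod.snd)
  omega

open Classical in
/-- A set `U` of vertices of a drawing spans at most `3 |U|` edges. -/
theorem card_edges_induced_le (h : IsMonotoneDrawing X Y R F) (U : Finset V) :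
    {p ∈ U ×ˢ U | R p.1 p.2}.card ≤ 3 * U.card := by
  have := (h.restrict (U : Set V)).card_edges_le
  simp only [Finset.coe_sort_coe, Fintype.card_coe] at this
  refine le_trans ?_ this
  refine Finset.card_le_card_of_surjOn (fun p : U × U => ((p.1 : V), (p.2 : V))) ?_
  rintro ⟨a, b⟩ hp
  simp only [Finset.coe_filter, Finset.mem_product, Set.mem_ofPred_eq] at hp
  exact ⟨(⟨a, hp.1.1⟩, ⟨b, hp.1.2⟩), by simpa using hp.2, rfl⟩

end IsMonotoneDrawing

/-! ### From plane embeddings to monotone drawings -/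

/-- A Jordan arc on which the coordinate `X` is injective is the graph of a continuous function
over the interval between the coordinates of its endpoints. -/
theorem IsJordanArc.exists_continuousOn {A : Set Plane} {a b : Plane} (hA : IsJordanArc A a b)
    {X Y : Plane → ℝ} (hX : Continuous X) (hY : Continuous Y) (hinj : Set.InjOn X A) :
    a ∈ A ∧ b ∈ A ∧ ∃ f : ℝ → ℝ, ContinuousOn f (Set.Icc (X a) (X b)) ∧
      ∀ x ∈ Set.Icc (X a) (X b), ∃ p ∈ A, X p = x ∧ Y p = f x := by
  obtain ⟨γ, hγ, hγi, rfl, rfl, rfl⟩ := hA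
  refine ⟨⟨0, rfl⟩, ⟨1, rfl⟩, ?_⟩
  have hc : Continuous (X ∘ γ) := hX.comp hγ
  have hi : Function.Injective (X ∘ γ) := fun s t hst => hγi (hinj ⟨s, rfl⟩ ⟨t, rfl⟩ hst)
  have hsub : Set.Icc (X (γ 0)) (X (γ 1)) ⊆ Set.range (X ∘ γ) := intermediate_value_univ 0 1 hc
  have hf : ∀ t, Function.extend (X ∘ γ) (Y ∘ γ) 0 (X (γ t)) = Y (γ t) :=
    fun t => hi.extend_apply (Y ∘ γ) 0 t
  refine ⟨Function.extend (X ∘ γ) (Y ∘ γ) 0, ContinuousOn.mono ?_ hsub, ?_⟩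
  · rw [continuousOn_iff_continuous_domRestrict]
    -- By compactness `X ∘ γ` is a homeomorphism onto its range, so continuity can be tested after
    -- pulling back to the parameter interval.
    let e := (hc.isClosedEmbedding hi).isEmbedding.toHomeomorph
    rw [← e.comp_continuous_iff']
    have : (Set.range (X ∘ γ)).domRestrict (Function.extend (X ∘ γ) (Y ∘ γ) 0) ∘ e = Y ∘ γ := by
      ext t
      exact hf t
    rw [this]
    exact hY.comp hγ
  · intro x hx
    obtain ⟨t, rfl⟩ := hsub hx
    exact ⟨γ t, ⟨t, rfl⟩, rfl, (hf t).symm⟩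

theorem IsPlaneEmbedding.exists_isMonotoneDrawing {P : Finset Plane} {G : SimpleGraph P}
    {arc : Sym2 P → Set Plane} (hG : IsPlaneEmbedding G arc) {X Y : Plane → ℝ}
    (hX : Continuous X) (hY : Continuous Y) (hXY : ∀ p q, X p = X q → Y p = Y q → p = q)
    (hmono : ∀ a b : P, G.Adj a b → X a < X b → Set.InjOn X (arc s(a, b))) :
    ∃ F, IsMonotoneDrawing (fun v : P => X v) (fun v : P => Y v)
      (fun a b => G.Adj a b ∧ X a < X b) F := by
  have hex : ∀ a b : P, ∃ f : ℝ → ℝ, G.Adj a b ∧ X a < X b →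
      ContinuousOn f (Set.Icc (X a) (X b)) ∧
      ∀ x ∈ Set.Icc (X a) (X b), ∃ p ∈ arc s(a, b), X p = x ∧ Y p = f x := by
    intro a b
    by_cases h : G.Adj a b ∧ X a < X b
    · obtain ⟨-, -, f, hf⟩ :=
        (hG.isJordanArc a b h.1).exists_continuousOn hX hY (hmono a b h.1 h.2)
      exact ⟨f, fun _ => hf⟩
    · exact ⟨0, fun h' => absurd h' h⟩
  choose F hF using hex
  have hends : ∀ a b : P, G.Adj a b ∧ X a < X b →
      (a : Plane) ∈ arc s(a, b) ∧ (b : Plane) ∈ arc s(a, b) := fun a b h => by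
    obtain ⟨ha, hb, -⟩ :=
      (hG.isJordanArc a b h.1).exists_continuousOn hX hY (hmono a b h.1 h.2)
    exact ⟨ha, hb⟩
  have hpt : ∀ a b : P, G.Adj a b ∧ X a < X b → ∀ p ∈ arc s(a, b), X p ∈ Set.Icc (X a) (X b) →
      F a b (X p) = Y p := by
    intro a b h p hp hx
    obtain ⟨q, hq, hqX, hqY⟩ := (hF a b h).2 _ hx
    rw [← hqY, hmono a b h.1 h.2 hq hp hqX]
  refine ⟨F, fun a b h => h.2, fun a b h => (hF a b h).1,
    fun a b h => hpt a b h _ (hends a b h).1 ⟨le_rfl, h.2.le⟩,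
    fun a b h => hpt a b h _ (hends a b h).2 ⟨h.2.le, le_rfl⟩, ?_, ?_⟩
  · intro a b h v hv he
    obtain ⟨p, hp, hpX, hpY⟩ := (hF a b h).2 _ hv
    have hpv : p = v := hXY _ _ hpX (hpY.trans he)
    rw [hpv] at hp
    simpa using hG.vertex_mem s(a, b) h.1 v hp
  · intro a b c d h h' hne x hx hx' he
    obtain ⟨p, hp, hpX, hpY⟩ := (hF a b h).2 _ hx
    obtain ⟨q, hq, hqX, hqY⟩ := (hF c d h').2 _ hx'
    have hpq : p = q := hXY _ _ (hpX.trans hqX.symm) (hpY.trans (he.trans hqY.symm))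
    -- Only one orientation of an edge goes from left to right, so distinct directed edges are
    -- distinct as unordered edges.
    have hne' : s(a, b) ≠ s(c, d) := by
      intro hs
      rcases Sym2.eq_iff.1 hs with ⟨rfl, rfl⟩ | ⟨rfl, rfl⟩
      · exact hne rfl
      · exact lt_asymm h.2 h'.2
    obtain ⟨v, hv, hv', rfl⟩ := hG.disjoint _ h.1 _ h'.1 hne' p ⟨hp, hpq ▸ hq⟩
    exact ⟨v, by simpa using hv, by simpa using hv', hpX⟩

theorem inner_plane (p u : Plane) : inner ℝ p u = p 0 * u 0 + p 1 * u 1 := by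
  simp [PiLp.inner_apply, Fin.sum_univ_two, mul_comm]

/-- The two quantities are orthogonal coordinates of the point, scaled by the norm of `u`. -/
theorem plane_ext_of_inner {u : Plane} (hu : u ≠ 0) (p q : Plane)
    (h : inner ℝ p u = inner ℝ q u) (h' : p 1 * u 0 - p 0 * u 1 = q 1 * u 0 - q 0 * u 1) :
    p = q := by
  rw [inner_plane, inner_plane] at h
  have hn : 0 < u 0 ^ 2 + u 1 ^ 2 := by
    by_contra hcon
    apply hu
    ext i
    fin_cases i
    · show u 0 = 0
      nlinarith [sq_nonneg (u 0), sq_nonneg (u 1)]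
    · show u 1 = 0
      nlinarith [sq_nonneg (u 0), sq_nonneg (u 1)]
  ext i
  fin_cases i
  · show p 0 = q 0
    apply mul_right_cancel₀ hn.ne'
    linear_combination u 0 * h - u 1 * h'
  · show p 1 = q 1
    apply mul_right_cancel₀ hn.ne'
    linear_combination u 1 * h + u 0 * h'

/-- The edges of a plane graph that are monotone in direction `u`, rotated to a drawing from left to
right. -/
theorem IsPlaneEmbedding.exists_isMonotoneDrawing_inner {P : Finset Plane} {G : SimpleGraph P}
    {arc : Sym2 P → Set Plane} (hG : IsPlaneEmbedding G arc) {u : Plane} (hu : u ≠ 0)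
    (hmono : ∀ a b : P, G.Adj a b → inner ℝ (a : Plane) u < inner ℝ (b : Plane) u →
      Set.InjOn (fun p => inner ℝ p u) (arc s(a, b))) :
    ∃ F, IsMonotoneDrawing (fun v : P => inner ℝ (v : Plane) u)
      (fun v : P => (v : Plane) 1 * u 0 - (v : Plane) 0 * u 1)
      (fun a b => G.Adj a b ∧ inner ℝ (a : Plane) u < inner ℝ (b : Plane) u) F :=
  hG.exists_isMonotoneDrawing (X := fun p => inner ℝ p u)
    (Y := fun p => p 1 * u 0 - p 0 * u 1) (by fun_prop) (by fun_prop)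
    (plane_ext_of_inner hu) hmono

theorem IsPlaneEmbedding.ncard_monotone_le {α : ℝ} (h0 : α ^ 3 - α ^ 2 - α - 1 = 0)
    (h1 : (1.8392 : ℝ) < α) (h2 : α < (1.8393 : ℝ)) {P : Finset Plane} {G : SimpleGraph P}
    {arc : Sym2 P → Set Plane} (hG : IsPlaneEmbedding G arc) {u : Plane} (hu : u ≠ 0)
    (hmono : ∀ a b : P, G.Adj a b → inner ℝ (a : Plane) u < inner ℝ (b : Plane) u →
      Set.InjOn (fun p => inner ℝ p u) (arc s(a, b))) :
    {l : List P | IsMonotonePathInDirection G u l}.Finite ∧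
      ({l : List P | IsMonotonePathInDirection G u l}.ncard : ℝ) ≤ 6 * α ^ P.card := by
  obtain ⟨F, hF⟩ := hG.exists_isMonotoneDrawing_inner hu hmono
  have key := ncard_isChain_le h0 h1 h2
    -- Vertices may tie in direction `u`; the perpendicular coordinate breaks ties to make the key
    -- injective.
    (key := fun v : P => toLex (inner ℝ (v : Plane) u,
      (v : Plane) 1 * u 0 - (v : Plane) 0 * u 1))
    (R := fun a b => G.Adj a b ∧ inner ℝ (a : Plane) u < inner ℝ (b : Plane) u)
    (by
      intro p q hpq
      have hpq := toLex.injective hpq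
      rw [Prod.mk.injEq] at hpq
      exact Subtype.ext (plane_ext_of_inner hu _ _ hpq.1 hpq.2))
    (fun a b hab => Prod.Lex.toLex_lt_toLex.2 (Or.inl hab.2))
    hF.card_edges_induced_le
  rw [Fintype.card_coe] at key
  simpa only [IsMonotonePathInDirection, inner_sub_left, sub_pos] using key

theorem injOn_inner_segment {a b u : Plane} (h : inner ℝ a u < inner ℝ b u) :
    Set.InjOn (fun p => inner ℝ p u) (segment ℝ a b) := by
  intro p hp q hq hpq
  rw [segment_eq_image_lineMap] at hp hq
  obtain ⟨s, -, rfl⟩ := hp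
  obtain ⟨t, -, rfl⟩ := hq
  simp only [AffineMap.lineMap_apply, vsub_eq_sub, vadd_eq_add, inner_add_left, inner_smul_left,
    inner_sub_left, add_left_inj, RCLike.conj_to_real] at hpq
  rw [mul_right_cancel₀ (sub_pos.2 h).ne' hpq]

/-! ### Reducing all directions to linearly many -/

/-- A direction slightly rotated from the left normal of `z` towards `z` has a positive scalar product
with the multiples of `z` and the vectors of `Z` to the left of `z`. -/
theorem exists_direction (Z : Finset Plane) (z : Plane) :
    ∃ u : Plane, u ≠ 0 ∧ ∀ w ∈ Z, (0 < z 0 * w 1 - z 1 * w 0 ∨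
      (z 0 * w 1 - z 1 * w 0 = 0 ∧ 0 < inner ℝ z w)) → 0 < inner ℝ w u := by
  open Filter Topology in
  -- Including `z` itself makes the resulting direction nonzero when `z ≠ 0`.
  have hev : ∀ᶠ ε in 𝓝[>] (0 : ℝ), ∀ w ∈ insert z Z, (0 < z 0 * w 1 - z 1 * w 0 ∨
      (z 0 * w 1 - z 1 * w 0 = 0 ∧ 0 < inner ℝ z w)) →
        0 < (z 0 * w 1 - z 1 * w 0) + ε * inner ℝ z w := by
    rw [eventually_all_finset]
    intro w _
    by_cases hdet : 0 < z 0 * w 1 - z 1 * w 0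
    · have ht : Tendsto (fun ε : ℝ => (z 0 * w 1 - z 1 * w 0) + ε * inner ℝ z w) (𝓝[>] 0)
          (𝓝 ((z 0 * w 1 - z 1 * w 0) + 0 * inner ℝ z w)) :=
        (Continuous.tendsto (by fun_prop) 0).mono_left nhdsWithin_le_nhds
      rw [zero_mul, add_zero] at ht
      filter_upwards [ht.eventually (lt_mem_nhds hdet)] with ε hε _ using hε
    · filter_upwards [self_mem_nhdsWithin] with ε hε h
      obtain ⟨h, h'⟩ := h.resolve_left hdet
      rw [h, zero_add]
      exact mul_pos hε h'
  obtain ⟨ε, hε⟩ := hev.exists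
  by_cases hz : z = 0
  · subst hz
    refine ⟨!₂[1, 0], fun h => ?_, fun w _ h => ?_⟩
    · simpa using congrArg (fun p : Plane => p 0) h
    · simp at h
  · have hin : ∀ w : Plane, inner ℝ w (!₂[-z 1 + ε * z 0, z 0 + ε * z 1] : Plane) =
        (z 0 * w 1 - z 1 * w 0) + ε * inner ℝ z w := by
      intro w
      rw [inner_plane, inner_plane]
      simp
      ring
    refine ⟨!₂[-z 1 + ε * z 0, z 0 + ε * z 1], fun h => ?_, fun w hw h => ?_⟩
    · have := hε z (Finset.mem_insert_self _ _)
        (Or.inr ⟨by ring, real_inner_self_pos.2 hz⟩)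
      rw [← hin, h, inner_zero_right] at this
      exact lt_irrefl _ this
    · rw [hin]
      exact hε w (Finset.mem_insert_of_mem hw) h

/-- Finitely many vectors are, up to inclusion, split in linearly many ways by open half-planes. -/
theorem exists_finset_directions (Z : Finset Plane) :
    ∃ D : Finset Plane, D.card ≤ Z.card + 1 ∧ (∀ u ∈ D, u ≠ 0) ∧
      ∀ u : Plane, ∃ u' ∈ D, ∀ z ∈ Z, 0 < inner ℝ z u → 0 < inner ℝ z u' := by
  classical
  choose d hd0 hd using exists_direction Z
  -- The direction `d 0` is a default for half-planes that contain no vector of `Z`.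
  refine ⟨insert (d 0) (Z.image d), (Finset.card_insert_le _ _).trans
    (Nat.succ_le_succ Finset.card_image_le), ?_, ?_⟩
  · intro u hu
    rcases Finset.mem_insert.1 hu with rfl | hu
    · exact hd0 _
    · obtain ⟨z, -, rfl⟩ := Finset.mem_image.1 hu
      exact hd0 z
  · intro u
    by_cases hne : {z ∈ Z | 0 < inner ℝ z u}.Nonempty
    -- The ratio is the tangent of the signed angle from `u`, so `z` is the clockwise-most vector in
    -- the half-plane and every other one is to its left or parallel to it.
    · obtain ⟨z, hz, hmin⟩ := Finset.exists_min_image _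
        (fun z : Plane => (z 1 * u 0 - z 0 * u 1) / inner ℝ z u) hne
      obtain ⟨hzZ, hzu⟩ := Finset.mem_filter.1 hz
      refine ⟨d z, Finset.mem_insert_of_mem (Finset.mem_image_of_mem _ hzZ), ?_⟩
      intro w hw hwu
      refine hd z w hw ?_
      have hle := hmin w (Finset.mem_filter.2 ⟨hw, hwu⟩)
      rw [div_le_div_iff₀ hzu hwu] at hle
      rw [inner_plane] at hzu hwu ⊢
      rw [inner_plane, inner_plane] at hle
      have hn : 0 < u 0 ^ 2 + u 1 ^ 2 := by
        by_contra hcon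
        have e0 : u 0 = 0 := by nlinarith [sq_nonneg (u 0), sq_nonneg (u 1)]
        have e1 : u 1 = 0 := by nlinarith [sq_nonneg (u 0), sq_nonneg (u 1)]
        rw [e0, e1] at hzu
        simp at hzu
      have hdet : 0 ≤ (z 0 * w 1 - z 1 * w 0) * (u 0 ^ 2 + u 1 ^ 2) := by
        linarith
      rcases lt_or_eq_of_le (nonneg_of_mul_nonneg_left hdet hn) with hlt | heq
      · exact Or.inl hlt
      · refine Or.inr ⟨heq.symm, ?_⟩
        have hdot : (z 0 * w 0 + z 1 * w 1) * (z 0 * u 0 + z 1 * u 1) =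
          (w 0 * u 0 + w 1 * u 1) * (z 0 ^ 2 + z 1 ^ 2) := by
          linear_combination (z 1 * u 0 - z 0 * u 1) * heq.symm
        have hz0 : 0 < z 0 ^ 2 + z 1 ^ 2 := by
          by_contra hcon
          have e0 : z 0 = 0 := by nlinarith [sq_nonneg (z 0), sq_nonneg (z 1)]
          have e1 : z 1 = 0 := by nlinarith [sq_nonneg (z 0), sq_nonneg (z 1)]
          rw [e0, e1] at hzu
          simp at hzu
        exact (mul_pos_iff_of_pos_right hzu).1 (hdot ▸ mul_pos hwu hz0)
    · refine ⟨d 0, Finset.mem_insert_self _ _, fun z hz hzu => ?_⟩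
      exact absurd ⟨z, Finset.mem_filter.2 ⟨hz, hzu⟩⟩ hne

/-! ### Straight-line graphs and paths in all directions -/

section StraightLine

variable {P : Finset Plane} {G : SimpleGraph P}

theorem segment_injOn_of_arc {arc : Sym2 P → Set Plane}
    (harc : ∀ a b : P, G.Adj a b → arc s(a, b) = segment ℝ (a : Plane) (b : Plane)) (u : Plane)
    (a b : P) (hab : G.Adj a b) (h : inner ℝ (a : Plane) u < inner ℝ (b : Plane) u) :
    Set.InjOn (fun p => inner ℝ p u) (arc s(a, b)) := by
  rw [harc a b hab]
  exact injOn_inner_segment h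

theorem IsPlaneStraightLine.ncard_monotone_le {α : ℝ} (h0 : α ^ 3 - α ^ 2 - α - 1 = 0)
    (h1 : (1.8392 : ℝ) < α) (h2 : α < (1.8393 : ℝ)) (hG : IsPlaneStraightLine G) {u : Plane}
    (hu : u ≠ 0) :
    {l : List P | IsMonotonePathInDirection G u l}.Finite ∧
      ({l : List P | IsMonotonePathInDirection G u l}.ncard : ℝ) ≤ 6 * α ^ P.card := by
  obtain ⟨arc, hE, harc⟩ := hG
  exact hE.ncard_monotone_le h0 h1 h2 hu (segment_injOn_of_arc harc u)

open Classical in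
theorem IsPlaneStraightLine.card_inner_lt_le (hG : IsPlaneStraightLine G) {u : Plane}
    (hu : u ≠ 0) :
    (Finset.univ.filter fun p : P × P =>
      G.Adj p.1 p.2 ∧ inner ℝ (p.1 : Plane) u < inner ℝ (p.2 : Plane) u).card ≤ 3 * P.card := by
  obtain ⟨arc, hE, harc⟩ := hG
  obtain ⟨F, hF⟩ := hE.exists_isMonotoneDrawing_inner hu (segment_injOn_of_arc harc u)
  have h := hF.card_edges_le
  rw [Fintype.card_coe] at h
  convert h

open Classical in
/-- A plane straight-line graph has linearly many edges. -/
theorem IsPlaneStraightLine.card_adj_le (hG : IsPlaneStraightLine G) :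
    (Finset.univ.filter fun p : P × P => G.Adj p.1 p.2).card ≤ 12 * P.card := by
  have h := fun (u : Plane) (hu : u ≠ 0) => hG.card_inner_lt_le hu
  have hunit : ∀ i : Fin 2, (EuclideanSpace.single i (1 : ℝ) : Plane) ≠ 0 := fun i => by simp
  have hneg : ∀ i : Fin 2, -(EuclideanSpace.single i (1 : ℝ) : Plane) ≠ 0 :=
    fun i => neg_ne_zero.2 (hunit i)
  set E : Plane → Finset (P × P) := fun u => Finset.univ.filter fun p : P × P =>
    G.Adj p.1 p.2 ∧ inner ℝ (p.1 : Plane) u < inner ℝ (p.2 : Plane) u with hEdef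
  -- Adjacent vertices differ in some coordinate, so each ordered pair increases in one of four axis
  -- directions, each contributing at most `3 n` pairs.
  have hsub : (Finset.univ.filter fun p : P × P => G.Adj p.1 p.2) ⊆
      (E (EuclideanSpace.single 0 1) ∪ E (-EuclideanSpace.single 0 1)) ∪
      (E (EuclideanSpace.single 1 1) ∪ E (-EuclideanSpace.single 1 1)) := by
    rintro ⟨a, b⟩ hab
    have hab : G.Adj a b := (Finset.mem_filter.1 hab).2
    simp only [hEdef, Finset.mem_union, Finset.mem_filter, Finset.mem_univ, true_and, hab,
      inner_neg_right, EuclideanSpace.inner_single_right, one_mul, neg_lt_neg_iff,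
      RCLike.conj_to_real]
    by_contra hcon
    simp only [not_or, not_lt] at hcon
    apply hab.ne
    ext i
    fin_cases i
    · exact le_antisymm hcon.1.2 hcon.1.1
    · exact le_antisymm hcon.2.2 hcon.2.1
  have e1 := h _ (hunit 0)
  have e2 := h _ (hneg 0)
  have e3 := h _ (hunit 1)
  have e4 := h _ (hneg 1)
  have c0 := (Finset.card_le_card hsub).trans (Finset.card_union_le _ _)
  have c1 := Finset.card_union_le (E (EuclideanSpace.single 0 1)) (E (-EuclideanSpace.single 0 1))
  have c2 := Finset.card_union_le (E (EuclideanSpace.single 1 1)) (E (-EuclideanSpace.single 1 1))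
  simp only [hEdef] at c0 c1 c2
  omega

theorem IsPlaneStraightLine.ncard_monotonePaths_le {α : ℝ} (h0 : α ^ 3 - α ^ 2 - α - 1 = 0)
    (h1 : (1.8392 : ℝ) < α) (h2 : α < (1.8393 : ℝ)) (hG : IsPlaneStraightLine G) :
    (monotonePaths G).Finite ∧
      ((monotonePaths G).ncard : ℝ) ≤ 84 * (P.card * α ^ P.card) := by
  classical
  have hpos : 0 < α := by norm_num at h1; linarith
  rcases P.eq_empty_or_nonempty with rfl | hP
  · have : monotonePaths G = ∅ := by
      refine Set.eq_empty_of_forall_notMem ?_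
      rintro l ⟨u, -, hne, -⟩
      obtain ⟨v, -⟩ := List.exists_mem_of_ne_nil l hne
      exact absurd v.2 (Finset.notMem_empty _)
    simp [this]
  set Z : Finset Plane := (Finset.univ.filter fun p : P × P => G.Adj p.1 p.2).image
    fun p => (p.2 : Plane) - p.1 with hZ
  obtain ⟨D, hDcard, hD0, hD⟩ := exists_finset_directions Z
  have hsub : monotonePaths G ⊆ ⋃ u ∈ D, {l : List P | IsMonotonePathInDirection G u l} := by
    rintro l ⟨u, -, hne, hl⟩
    obtain ⟨u', hu', hZu⟩ := hD u
    simp only [Set.mem_iUnion]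
    refine ⟨u', hu', hne, hl.imp fun a b hab => ⟨hab.1, hZu _ ?_ hab.2⟩⟩
    exact Finset.mem_image.2 ⟨(a, b), Finset.mem_filter.2 ⟨Finset.mem_univ _, hab.1⟩, rfl⟩
  have hfin : (⋃ u ∈ D, {l : List P | IsMonotonePathInDirection G u l}).Finite :=
    Set.Finite.biUnion D.finite_toSet fun u hu => (hG.ncard_monotone_le h0 h1 h2 (hD0 u hu)).1
  refine ⟨hfin.subset hsub, ?_⟩
  -- Here `12 n + 1 ≤ 13 n` needs a nonempty vertex set.
  have hDn : (D.card : ℝ) ≤ 13 * P.card := by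
    have e1 : Z.card ≤ 12 * P.card := Finset.card_image_le.trans hG.card_adj_le
    have e2 := hP.card_pos
    exact_mod_cast (by omega : D.card ≤ 13 * P.card)
  calc ((monotonePaths G).ncard : ℝ)
      ≤ ((∑ u ∈ D, {l : List P | IsMonotonePathInDirection G u l}.ncard : ℕ) : ℝ) := by
        exact_mod_cast (Set.ncard_le_ncard hsub hfin).trans (Finset.set_ncard_biUnion_le _ _)
    _ ≤ ∑ u ∈ D, 6 * α ^ P.card := by
        push_cast
        exact Finset.sum_le_sum fun u hu => (hG.ncard_monotone_le h0 h1 h2 (hD0 u hu)).2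
    _ = D.card * (6 * α ^ P.card) := by rw [Finset.sum_const, nsmul_eq_mul]
    _ ≤ (13 * P.card) * (6 * α ^ P.card) := by gcongr
    _ ≤ _ := by
        have : 0 ≤ (P.card : ℝ) * α ^ P.card := by positivity
        linarith

end StraightLine

theorem inner_unit_x (p : Plane) : inner ℝ p (!₂[(1 : ℝ), 0] : Plane) = p 0 := by
  rw [inner_plane]
  simp

theorem unit_x_ne_zero : (!₂[(1 : ℝ), 0] : Plane) ≠ 0 := fun h => by
  simpa using congrArg (fun p : Plane => p 0) h

theorem theorem2 :
    ∃ α : ℝ, (α ^ 3 - α ^ 2 - α - 1 = 0 ∧ (∀ y : ℝ, y ^ 3 - y ^ 2 - y - 1 = 0 → y = α) ∧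
        (1.8392 : ℝ) < α ∧ α < (1.8393 : ℝ)) ∧
      ∃ C : ℝ, 0 < C ∧ ∀ (n : ℕ) (P : Finset Plane), P.card = n → ∀ G : SimpleGraph P,
        (IsTriangulation G →
          (xMonotonePaths G).Finite ∧ ((xMonotonePaths G).ncard : ℝ) ≤ C * α ^ n ∧
          (monotonePaths G).Finite ∧ ((monotonePaths G).ncard : ℝ) ≤ C * (n * α ^ n)) ∧
        (IsPlaneStraightLine G →
          (xMonotonePaths G).Finite ∧ ((xMonotonePaths G).ncard : ℝ) ≤ C * α ^ n ∧
          (monotonePaths G).Finite ∧ ((monotonePaths G).ncard : ℝ) ≤ C * (n * α ^ n)) ∧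
        (IsPlaneMonotone G →
          (xMonotonePaths G).Finite ∧ ((xMonotonePaths G).ncard : ℝ) ≤ C * α ^ n) := by
  obtain ⟨α, hα⟩ := exists_tribonacci_constant
  refine ⟨α, hα, 84, by norm_num, ?_⟩
  obtain ⟨h0, -, h1, h2⟩ := hα
  rintro n P rfl G
  have hpos : 0 ≤ α ^ P.card := pow_nonneg (by norm_num at h1; linarith) _
  have hstraight : IsPlaneStraightLine G →
      (xMonotonePaths G).Finite ∧ ((xMonotonePaths G).ncard : ℝ) ≤ 84 * α ^ P.card ∧
      (monotonePaths G).Finite ∧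
        ((monotonePaths G).ncard : ℝ) ≤ 84 * (P.card * α ^ P.card) := fun hG => by
    obtain ⟨hf, hc⟩ := hG.ncard_monotone_le h0 h1 h2 unit_x_ne_zero
    exact ⟨hf, hc.trans (by linarith), hG.ncard_monotonePaths_le h0 h1 h2⟩
  refine ⟨fun hG => hstraight hG.prop, hstraight, ?_⟩
  rintro ⟨arc, hE, harc⟩
  obtain ⟨hf, hc⟩ := hE.ncard_monotone_le h0 h1 h2 unit_x_ne_zero (fun a b hab _ p hp q hq hpq =>
    harc s(a, b) hab p hp q hq (by simpa only [inner_unit_x] using hpq))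
  exact ⟨hf, hc.trans (by linarith)⟩
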